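/- For every $0<\varepsilon<1$ there exist $\delta>0$ and $n_0$ (depending only on $\varepsilon$) such that for all $n>n_0$ and all integers $0\le b\le (1-\varepsilon)n/2$ the following holds. In the $(1:b)$ Client-Waiter game on the edge set $E(K_n)$ of the complete graph on $n$ vertices, Client has a strategy which, however Waiter plays, guarantees that at the end of the game Client's graph contains a cycle of length at least $\delta n$. Here, in each round of the $(1:b)$ Client-Waiter game on $E(K_n)$, Waiter offers Client a set of at least one and at most $b+1$ unclaimed edges, Client claims one of them, and the rest of them are claimed by Waiter; the game ends when all edges have been claimed. -/

import Mathlib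

namespace ClientWaiter

/-- One round of a Client-Waiter game played on the edges of the complete graph on `V`:
the set of edges offered by Waiter, and the offered edge that Client claims.
All the other offered edges go to Waiter. -/
structure Round (V : Type*) where
  /-- the edges that Waiter offers -/
  offer : Finset (Sym2 V)
  /-- the edge that Client claims -/
  pick : Sym2 V

/-- A (deterministic) strategy of Client: given the history of the game (the most recent round
first) and the nonempty set of edges that Waiter offers now, it names one of these edges. -/
structure Strategy (V : Type*) where
  /-- the edge that Client claims -/
  choose : List (Round V) → (S : Finset (Sym2 V)) → S.Nonempty → Sym2 V
  choose_mem : ∀ (h : List (Round V)) (S : Finset (Sym2 V)) (hS : S.Nonempty), choose h S hS ∈ S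

/-- The edges of the complete graph on `V` that no player has claimed after the history `h`. -/
def unclaimed {V : Type*} [Fintype V] [DecidableEq V] (h : List (Round V)) : Finset (Sym2 V) :=
  (⊤ : SimpleGraph V).edgeFinset.filter (fun e => ∀ r ∈ h, e ∉ r.offer)

/-- Client's graph after the history `h`: its edges are the ones that Client has claimed. -/
def clientGraph {V : Type*} (h : List (Round V)) : SimpleGraph V :=
  SimpleGraph.fromEdgeSet {e | ∃ r ∈ h, r.pick = e}

/-- The histories (the most recent round first) that can arise in the `(1 : b)` Client-Waiter game
on the edges of the complete graph on `V` when Client follows the strategy `σ`: in each round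
Waiter offers at least one and at most `b + 1` unclaimed edges, of his choice, and Client claims
the one that `σ` names. -/
inductive IsPlay {V : Type*} [Fintype V] [DecidableEq V] (b : ℕ) (σ : Strategy V) :
    List (Round V) → Prop
  | nil : IsPlay b σ []
  | cons (h : List (Round V)) (S : Finset (Sym2 V)) (hS : S.Nonempty) :
      IsPlay b σ h → S ⊆ unclaimed h → S.card ≤ b + 1 →
      IsPlay b σ (⟨S, σ.choose h S hS⟩ :: h)

/-- Following `σ`, Client wins the `(1 : b)` game with target property `P`, whatever Waiter does:
at the end of the game, that is, when all the edges have been claimed, Client's graph has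
the property `P`. -/
def Strategy.IsWinning {V : Type*} [Fintype V] [DecidableEq V] (σ : Strategy V) (b : ℕ)
    (P : SimpleGraph V → Prop) : Prop :=
  ∀ h : List (Round V), IsPlay b σ h → unclaimed h = ∅ → P (clientGraph h)

/-- The graph `G` contains a cycle of length at least `ℓ`. -/
def HasCycleOfLengthAtLeast {V : Type*} (G : SimpleGraph V) (ℓ : ℝ) : Prop :=
  ∃ (v : V) (c : G.Walk v v), c.IsCycle ∧ ℓ ≤ (c.length : ℝ)

end ClientWaiter

/-! Client imitates a random graph with edge probability `p = (2 + ε) / n`. Since `p * (b + 1) ≤ 1`,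
one can mark each offered edge with probability `p`, never two in a round. Averaging over this
choice does not increase `potential`, so some outcome does not increase it either
(`exists_potential_le`). If that outcome marks nothing, Client claims any offered edge and leaves it
unmarked.

Let `κ = exp (-L)`. At the end the marked set `M` has about `(1 + ε/2) n` edges, while every `U`
with between `κn/4` and `κn` vertices spans fewer than `(1 + ε/8) |U|` of them
(`exists_strategy_sparse`).

Such a graph has a long cycle (`exists_cycle_of_sparse`). In a minimal vertex set `H` that is still
dense, every `W` of medium size has many outer neighbours in `H`: otherwise sparsity of `W` with its
neighbours would let `W` be deleted. Extend a path while a large region remains reachable behind its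
end. When it gets stuck, a medium-sized union of these regions has its whole boundary on the path,
and a boundary vertex far from the end closes a long cycle. -/

namespace ClientWaiter

/-! ### Client's strategy by derandomization -/

/-- The edges that Client has claimed after the history `h`. -/
def picks {V : Type*} [DecidableEq V] (h : List (Round V)) : Finset (Sym2 V) :=
  (h.map Round.pick).toFinset

theorem unclaimed_cons {V : Type*} [Fintype V] [DecidableEq V] (r : Round V) (h : List (Round V)) :
    unclaimed (r :: h) = unclaimed h \ r.offer := by
  ext e
  simp only [unclaimed, Finset.mem_filter, List.forall_mem_cons, Finset.mem_sdiff]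
  tauto

/-- Client can maintain any invariant of the pair (claimed edges, unclaimed edges) that he can
preserve in a single round. -/
theorem exists_strategy_of_invariant {V : Type*} [Fintype V] [DecidableEq V] (b : ℕ)
    (Inv : Finset (Sym2 V) → Finset (Sym2 V) → Prop)
    (h0 : Inv ∅ (⊤ : SimpleGraph V).edgeFinset)
    (step : ∀ C F S, Inv C F → S ⊆ F → S.Nonempty → S.card ≤ b + 1 →
      ∃ e ∈ S, Inv (insert e C) (F \ S)) :
    ∃ σ : Strategy V, ∀ h, IsPlay b σ h → Inv (picks h) (unclaimed h) := by
  classical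
  let good (h : List (Round V)) (S : Finset (Sym2 V)) : Prop :=
    ∃ e ∈ S, Inv (insert e (picks h)) (unclaimed h \ S)
  let σ : Strategy V :=
    -- The fallback `hS.choose` never occurs in a play, where the invariant makes every offer good.
    { choose := fun h S hS => if H : good h S then H.choose else hS.choose
      choose_mem := by
        intro h S hS
        by_cases H : good h S
        · simp only [H, dite_true]
          exact H.choose_spec.1
        · simp only [H, dite_false]
          exact hS.choose_spec }
  refine ⟨σ, fun h hh => ?_⟩
  induction hh with
  | nil => simpa [picks, unclaimed] using h0
  | cons h S hS _ hsub hcard ih =>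
    have H : good h S := step _ _ S ih hsub hS hcard
    have hc : σ.choose h S hS = H.choose := by simp only [σ, H, dite_true]
    rw [unclaimed_cons]
    have hp : picks (⟨S, σ.choose h S hS⟩ :: h) = insert H.choose (picks h) := by
      simp [picks, hc]
    rw [hp]
    exact H.choose_spec.2

/-- The potential that Client keeps from growing: an exponential weight for each vertex set in `𝒰`,
minus the expected number of edges at the end of the game. -/
noncomputable def potential {V : Type*} [DecidableEq V] (𝒰 : Finset (Finset V))
    (c : Finset V → ℝ) (p lam : ℝ) (M F : Finset (Sym2 V)) : ℝ :=
  ∑ U ∈ 𝒰, c U * (lam ^ (M ∩ U.sym2).card * (1 + p * (lam - 1)) ^ (F ∩ U.sym2).card)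
    - (M.card + p * F.card)

/-- The left side averages over marking each `e ∈ S` with probability `p` and nothing otherwise. The
linear part is preserved exactly. For the weights, marking at most one edge replaces independent
marking, and Bernoulli's inequality shows that this only lowers the average. -/
theorem potential_average_le {V : Type*} [DecidableEq V] (𝒰 : Finset (Finset V))
    (c : Finset V → ℝ) (hc : ∀ U ∈ 𝒰, 0 ≤ c U) {p lam : ℝ} (hp : 0 ≤ p) (hlam : 1 ≤ lam)
    {M F S : Finset (Sym2 V)} (hMF : Disjoint M F) (hS : S ⊆ F) :
    ∑ e ∈ S, p * potential 𝒰 c p lam (insert e M) (F \ S)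
      + (1 - p * S.card) * potential 𝒰 c p lam M (F \ S) ≤ potential 𝒰 c p lam M F := by
  have hSM : ∀ e ∈ S, e ∉ M := fun e he => Finset.disjoint_right.1 hMF (hS he)
  have hcard : (F.card : ℝ) = (F \ S).card + S.card := by
    rw [← Finset.card_sdiff_add_card_eq_card hS]; push_cast; ring
  have hlin : ∑ e ∈ S, p * (((insert e M).card : ℝ) + p * (F \ S).card)
      = p * S.card * (M.card + 1 + p * (F \ S).card) := by
    rw [Finset.sum_congr rfl (fun e he => by
      rw [Finset.card_insert_of_notMem (hSM e he)])]
    rw [Finset.sum_const, nsmul_eq_mul]; push_cast; ring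
  have hU : ∀ U ∈ 𝒰,
      ∑ e ∈ S, p * (c U * (lam ^ ((insert e M) ∩ U.sym2).card
          * (1 + p * (lam - 1)) ^ ((F \ S) ∩ U.sym2).card))
        + (1 - p * S.card) * (c U * (lam ^ (M ∩ U.sym2).card
          * (1 + p * (lam - 1)) ^ ((F \ S) ∩ U.sym2).card))
      ≤ c U * (lam ^ (M ∩ U.sym2).card * (1 + p * (lam - 1)) ^ (F ∩ U.sym2).card) := by
    intro U hUm
    have hF : (F ∩ U.sym2).card = ((F \ S) ∩ U.sym2).card + (S ∩ U.sym2).card := by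
      rw [← Finset.card_union_of_disjoint, ← Finset.union_inter_distrib_right,
        Finset.sdiff_union_of_subset hS]
      exact (Finset.sdiff_disjoint).mono Finset.inter_subset_left Finset.inter_subset_left
    have hins : ∀ e ∈ S, lam ^ ((insert e M) ∩ U.sym2).card
        = lam ^ (M ∩ U.sym2).card * (1 + if e ∈ U.sym2 then lam - 1 else 0) := by
      intro e he
      by_cases h : e ∈ U.sym2
      · rw [Finset.insert_inter_of_mem h, Finset.card_insert_of_notMem
          (fun h' => hSM e he (Finset.mem_inter.1 h').1), if_pos h, pow_succ]
        ring
      · rw [Finset.insert_inter_of_notMem h, if_neg h]; ring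
    have hsum : ∑ e ∈ S, (1 + if e ∈ U.sym2 then lam - 1 else 0)
        = S.card + (S ∩ U.sym2).card * (lam - 1) := by
      rw [Finset.sum_add_distrib, ← Finset.sum_filter, Finset.filter_mem_eq_inter]
      simp only [Finset.sum_const, nsmul_eq_mul, mul_one]
    have hb : 1 + ((S ∩ U.sym2).card : ℝ) * (p * (lam - 1))
        ≤ (1 + p * (lam - 1)) ^ (S ∩ U.sym2).card := by
      apply one_add_mul_le_pow
      have : 0 ≤ p * (lam - 1) := mul_nonneg hp (by linarith)
      linarith
    set f := (1 + p * (lam - 1)) ^ ((F \ S) ∩ U.sym2).card with hf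
    set a := lam ^ (M ∩ U.sym2).card with ha
    have hf0 : 0 ≤ f := pow_nonneg (by nlinarith [mul_nonneg hp (by linarith : 0 ≤ lam - 1)]) _
    have ha0 : 0 ≤ a := pow_nonneg (by linarith) _
    have e1 : ∑ e ∈ S, p * (c U * (lam ^ ((insert e M) ∩ U.sym2).card * f))
        = p * c U * a * f * (S.card + (S ∩ U.sym2).card * (lam - 1)) := by
      rw [← hsum, Finset.mul_sum]
      refine Finset.sum_congr rfl (fun e he => ?_)
      rw [hins e he]; ring
    rw [e1, hF, pow_add]
    have := mul_le_mul_of_nonneg_left hb (mul_nonneg (mul_nonneg (hc U hUm) ha0) hf0)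
    nlinarith [this]
  have := Finset.sum_le_sum hU
  rw [Finset.sum_add_distrib, Finset.sum_comm] at this
  simp only [potential, mul_sub, Finset.sum_sub_distrib, Finset.mul_sum] at this ⊢
  rw [hlin, hcard]
  nlinarith [this]

/-- In a round where at most `1 / p` edges are offered, Client can either ignore the round or
mark an offered edge without increasing the potential. -/
theorem exists_potential_le {V : Type*} [DecidableEq V] (𝒰 : Finset (Finset V))
    (c : Finset V → ℝ) (hc : ∀ U ∈ 𝒰, 0 ≤ c U) {p lam : ℝ} (hp : 0 ≤ p) (hlam : 1 ≤ lam)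
    {M F S : Finset (Sym2 V)} (hMF : Disjoint M F) (hS : S ⊆ F) (hpS : p * S.card ≤ 1) :
    potential 𝒰 c p lam M (F \ S) ≤ potential 𝒰 c p lam M F ∨
      ∃ e ∈ S, potential 𝒰 c p lam (insert e M) (F \ S) ≤ potential 𝒰 c p lam M F := by
  by_contra! hcon
  obtain ⟨h1, h2⟩ := hcon
  have havg := potential_average_le 𝒰 c hc hp hlam hMF hS
  have hge : ∑ e ∈ S, p * potential 𝒰 c p lam M F
      ≤ ∑ e ∈ S, p * potential 𝒰 c p lam (insert e M) (F \ S) :=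
    Finset.sum_le_sum fun e he => mul_le_mul_of_nonneg_left (h2 e he).le hp
  -- When `p * S.card = 1`, marking nothing has weight zero, so strictness must come from the sum
  -- over `S`.
  rcases hpS.lt_or_eq with hlt | heq
  · have := mul_lt_mul_of_pos_left h1 (sub_pos.2 hlt)
    rw [Finset.sum_const, nsmul_eq_mul] at hge
    nlinarith
  · have hne : S.Nonempty := by
      rw [← Finset.card_pos]
      rcases Nat.eq_zero_or_pos S.card with h | h
      · rw [h] at heq; simp at heq
      · exact h
    have hp' : 0 < p := by
      rcases hp.lt_or_eq with h | h
      · exact h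
      · rw [← h] at heq; simp at heq
    have hgt := Finset.sum_lt_sum_of_nonempty hne
      (fun e he => mul_lt_mul_of_pos_left (h2 e he) hp')
    rw [Finset.sum_const, nsmul_eq_mul] at hgt
    rw [← mul_assoc, mul_comm (S.card : ℝ), heq] at hgt
    rw [heq] at havg
    linarith

/-- Client has a strategy such that at the end of the game a subset of his edges has potential at
most the initial one. -/
theorem exists_strategy_potential_le {V : Type*} [Fintype V] [DecidableEq V] (b : ℕ)
    (𝒰 : Finset (Finset V)) (c : Finset V → ℝ) (hc : ∀ U ∈ 𝒰, 0 ≤ c U) {p lam : ℝ}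
    (hp : 0 ≤ p) (hlam : 1 ≤ lam) (hpb : p * (b + 1) ≤ 1) :
    ∃ σ : Strategy V, ∀ h, IsPlay b σ h → unclaimed h = ∅ →
      ∃ M ⊆ picks h, M ⊆ (⊤ : SimpleGraph V).edgeFinset ∧
        potential 𝒰 c p lam M ∅ ≤ potential 𝒰 c p lam ∅ (⊤ : SimpleGraph V).edgeFinset := by
  obtain ⟨σ, hσ⟩ := exists_strategy_of_invariant (V := V) b
    (fun C F => F ⊆ (⊤ : SimpleGraph V).edgeFinset ∧ ∃ M ⊆ C,
      M ⊆ (⊤ : SimpleGraph V).edgeFinset ∧ Disjoint M F ∧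
      potential 𝒰 c p lam M F ≤ potential 𝒰 c p lam ∅ (⊤ : SimpleGraph V).edgeFinset)
    ⟨subset_rfl, ∅, by simp, by simp, by simp, le_rfl⟩ (by
      rintro C F S ⟨hFE, M, hMC, hME, hMF, hpot⟩ hSF hSne hScard
      have hpS : p * S.card ≤ 1 := by
        refine le_trans (mul_le_mul_of_nonneg_left ?_ hp) hpb
        exact_mod_cast hScard
      have hdis : Disjoint M (F \ S) := hMF.mono_right Finset.sdiff_subset
      have hFE' : F \ S ⊆ (⊤ : SimpleGraph V).edgeFinset := Finset.sdiff_subset.trans hFE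
      rcases exists_potential_le 𝒰 c hc hp hlam hMF hSF hpS with h | ⟨e, he, h⟩
      · obtain ⟨e, he⟩ := hSne
        exact ⟨e, he, hFE', M, hMC.trans (Finset.subset_insert _ _), hME, hdis, h.trans hpot⟩
      · refine ⟨e, he, hFE', insert e M, Finset.insert_subset_insert _ hMC,
          Finset.insert_subset (hFE (hSF he)) hME, ?_, h.trans hpot⟩
        rw [Finset.disjoint_insert_left]
        exact ⟨fun h' => (Finset.mem_sdiff.1 h').2 he, hdis⟩)
  refine ⟨σ, fun h hh hu => ?_⟩
  obtain ⟨-, M, h1, h2, -, h3⟩ := hσ h hh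
  rw [hu] at h3
  exact ⟨M, h1, h2, h3⟩

/-! ### Long cycles from large outer boundaries -/

/-- Add the sets one at a time: if neither the union so far nor the next set reaches `k / 2`, their
union has at most `k` elements. -/
theorem exists_biUnion_card_between {V : Type*} [DecidableEq V] (C : V → Finset V) (k : ℕ)
    (Y : Finset V) (hC : ∀ y ∈ Y, (C y).card ≤ k) (hY : k ≤ 2 * (Y.biUnion C).card) :
    ∃ Z ⊆ Y, k ≤ 2 * (Z.biUnion C).card ∧ (Z.biUnion C).card ≤ k := by
  induction Y using Finset.induction_on with
  | empty => exact ⟨∅, subset_rfl, hY, by simp⟩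
  | insert y Y _ ih =>
    by_cases h : k ≤ 2 * (Y.biUnion C).card
    · obtain ⟨Z, hZ, h1, h2⟩ := ih (fun z hz => hC z (Finset.mem_insert_of_mem hz)) h
      exact ⟨Z, hZ.trans (Finset.subset_insert _ _), h1, h2⟩
    · by_cases h' : k ≤ 2 * (C y).card
      · exact ⟨{y}, by simp, by simpa using h', by simpa using hC y (Finset.mem_insert_self _ _)⟩
      · refine ⟨insert y Y, subset_rfl, hY, ?_⟩
        rw [Finset.biUnion_insert]
        have := Finset.card_union_le (C y) (Y.biUnion C)
        omega

/-- A path from `x` with a far vertex `u`, closed through a walk outside the path. -/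
theorem exists_cycle_of_path {V : Type*} [DecidableEq V] {G : SimpleGraph V} {t : ℕ} {x z u y w : V} (p : G.Walk x z) (hp : p.IsPath)
    (hu : u ∈ p.support) (hlen : t ≤ (p.takeUntil u hu).length) (ht : 1 ≤ t)
    (hxy : G.Adj x y) (q : G.Walk y w) (hq : ∀ v ∈ q.support, v ∉ p.support) (hwu : G.Adj w u) :
    ∃ (v : V) (c : G.Walk v v), c.IsCycle ∧ t + 2 ≤ c.length := by
  have hq' : ∀ v ∈ q.bypass.support, v ∉ p.support :=
    fun v hv => hq v (q.support_bypass_subset_support hv)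
  have hqp := q.bypass_isPath
  generalize q.bypass = r at hq' hqp
  have hux : u ≠ x := by
    rintro rfl
    simp at hlen
    omega
  set s := (p.takeUntil u hu).reverse with hs
  have hsp : s.IsPath := (hp.takeUntil hu).reverse
  have hss : ∀ v ∈ s.support, v ∈ p.support := by
    intro v hv
    rw [hs, SimpleGraph.Walk.support_reverse, List.mem_reverse] at hv
    exact p.support_takeUntil_subset_support hu hv
  have hwp : w ∉ p.support := hq' w r.end_mem_support
  refine ⟨w, SimpleGraph.Walk.cons hwu (s.append (SimpleGraph.Walk.cons hxy r)), ?_, ?_⟩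
  · rw [SimpleGraph.Walk.cons_isCycle_iff]
    constructor
    · rw [SimpleGraph.Walk.isPath_def, SimpleGraph.Walk.support_append,
        SimpleGraph.Walk.support_cons, List.tail_cons, List.nodup_append]
      refine ⟨hsp.support_nodup, hqp.support_nodup, ?_⟩
      rintro a ha b hb rfl
      exact hq' a hb (hss a ha)
    · rw [SimpleGraph.Walk.edges_append, SimpleGraph.Walk.edges_cons]
      intro h
      rcases List.mem_append.1 h with h | h
      · exact hwp (hss w (s.fst_mem_support_of_mem_edges h))
      · rcases List.mem_cons.1 h with h | h
        · rcases Sym2.eq_iff.1 h with ⟨rfl, -⟩ | ⟨-, h⟩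
          · exact hwp p.start_mem_support
          · exact hux h
        · exact hq' u (r.snd_mem_support_of_mem_edges h) hu
  · simp only [SimpleGraph.Walk.length_cons, SimpleGraph.Walk.length_append, hs,
      SimpleGraph.Walk.length_reverse]
    omega

/-- Fewer than `t` steps from the start, a walk visits at most `t` vertices. -/
theorem exists_far_mem {V : Type*} [DecidableEq V] {G : SimpleGraph V} {t : ℕ} {x z : V}
    (p : G.Walk x z) (N : Finset V)
    (hN : ∀ v ∈ N, v ∈ p.support) (ht : t < N.card) :
    ∃ u ∈ N, ∃ hu : u ∈ p.support, t ≤ (p.takeUntil u hu).length := by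
  by_contra! hcon
  have hsub : N ⊆ (Finset.range t).image p.getVert := by
    intro u hu
    refine Finset.mem_image.2 ⟨(p.takeUntil u (hN u hu)).length,
      Finset.mem_range.2 (hcon u hu (hN u hu)), ?_⟩
    exact p.getVert_length_takeUntil (hN u hu)
  have := (Finset.card_le_card hsub).trans Finset.card_image_le
  simp at this
  omega

section Reach

variable {V : Type*} [Fintype V] (G : SimpleGraph V)

open Classical in
/-- The vertices that can be reached from `y` by a walk that avoids `F`. -/
noncomputable def reachAvoiding (F : Finset V) (y : V) : Finset V :=
  {w | ∃ q : G.Walk y w, ∀ v ∈ q.support, v ∉ F}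

open Classical in
/-- The neighbours of `x` outside `F`. -/
noncomputable def neighborsAvoiding (F : Finset V) (x : V) : Finset V :=
  {z | G.Adj x z ∧ z ∉ F}

open Classical in
/-- The vertices outside `W` that have a neighbour in `W`. -/
noncomputable def outerBoundary (W : Finset V) : Finset V :=
  {v | v ∉ W ∧ ∃ w ∈ W, G.Adj w v}

variable {G}

theorem mem_reachAvoiding {F : Finset V} {y w : V} :
    w ∈ reachAvoiding G F y ↔ ∃ q : G.Walk y w, ∀ v ∈ q.support, v ∉ F := by
  simp [reachAvoiding]

theorem mem_neighborsAvoiding {F : Finset V} {x z : V} :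
    z ∈ neighborsAvoiding G F x ↔ G.Adj x z ∧ z ∉ F := by
  simp [neighborsAvoiding]

theorem mem_outerBoundary {W : Finset V} {v : V} :
    v ∈ outerBoundary G W ↔ v ∉ W ∧ ∃ w ∈ W, G.Adj w v := by
  simp [outerBoundary]

variable [DecidableEq V]

theorem reachAvoiding_subset_insert (F : Finset V) (y : V) :
    reachAvoiding G F y ⊆ insert y ((neighborsAvoiding G (insert y F) y).biUnion
      (reachAvoiding G (insert y F))) := by
  intro w hw
  obtain ⟨q, hq⟩ := mem_reachAvoiding.1 hw
  have hq' : ∀ v ∈ q.bypass.support, v ∉ F := fun v hv => hq v (q.support_bypass_subset_support hv)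
  have hpath := q.bypass_isPath
  generalize q.bypass = r at hq' hpath
  cases r with
  | nil => simp
  | cons hadj r =>
    rw [SimpleGraph.Walk.cons_isPath_iff] at hpath
    have key : ∀ v ∈ r.support, v ∉ insert y F := by
      intro v hv hv'
      rcases Finset.mem_insert.1 hv' with rfl | hv'
      · exact hpath.2 hv
      · exact hq' v (by simp [hv]) hv'
    refine Finset.mem_insert_of_mem (Finset.mem_biUnion.2 ⟨_, ?_, mem_reachAvoiding.2 ⟨r, key⟩⟩)
    exact mem_neighborsAvoiding.2 ⟨hadj, key _ r.start_mem_support⟩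

theorem outerBoundary_biUnion_reachAvoiding_subset (F Z : Finset V) :
    outerBoundary G (Z.biUnion (reachAvoiding G F)) ⊆ F := by
  intro v hv
  obtain ⟨hv, w, hw, hadj⟩ := mem_outerBoundary.1 hv
  by_contra hvF
  obtain ⟨y, hy, hw⟩ := Finset.mem_biUnion.1 hw
  obtain ⟨q, hq⟩ := mem_reachAvoiding.1 hw
  refine hv (Finset.mem_biUnion.2 ⟨y, hy, mem_reachAvoiding.2 ⟨q.concat hadj, ?_⟩⟩)
  intro u hu
  rw [SimpleGraph.Walk.support_concat] at hu
  rcases (by simpa using hu : u ∈ q.support ∨ u = v) with hu | rfl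
  · exact hq u hu
  · exact hvF

/-- If no vertex of `Y` can be used to continue, then some union of the regions behind the
vertices of `Y` has about `k` vertices and all its outer boundary in `F`. -/
theorem exists_boundary_subset {k : ℕ} (F Y : Finset V)
    (hY : k ≤ (Y.biUnion (reachAvoiding G F)).card)
    (hsmall : ∀ y ∈ Y, ((neighborsAvoiding G (insert y F) y).biUnion
      (reachAvoiding G (insert y F))).card < k) :
    ∃ Z ⊆ Y, k ≤ 2 * (Z.biUnion (reachAvoiding G F)).card ∧
      (Z.biUnion (reachAvoiding G F)).card ≤ k ∧
      outerBoundary G (Z.biUnion (reachAvoiding G F)) ⊆ F := by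
  obtain ⟨Z, h1, h2, h3⟩ := exists_biUnion_card_between (reachAvoiding G F) k Y (by
    intro y hy
    have h1 := Finset.card_le_card (reachAvoiding_subset_insert (G := G) F y)
    have h2 := Finset.card_insert_le y ((neighborsAvoiding G (insert y F) y).biUnion
      (reachAvoiding G (insert y F)))
    have h3 := hsmall y hy
    omega) (by omega)
  exact ⟨Z, h1, h2, h3, outerBoundary_biUnion_reachAvoiding_subset F Z⟩

/-- The path grows at `x`, keeping at least `k` vertices reachable behind `x`. Induction is on the
room `m` left for growth, as a path has fewer edges than there are vertices. -/
theorem exists_cycle_of_path_of_boundary {k t : ℕ} (ht : 2 ≤ t)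
    (hexp : ∀ W : Finset V, k ≤ 2 * W.card → W.card ≤ k → t ≤ (outerBoundary G W).card)
    (m : ℕ) {x z : V} (p : G.Walk x z) (hp : p.IsPath) (hm : Fintype.card V ≤ p.length + m)
    (hk : k ≤ ((neighborsAvoiding G p.support.toFinset x).biUnion
      (reachAvoiding G p.support.toFinset)).card) :
    ∃ (v : V) (c : G.Walk v v), c.IsCycle ∧ t + 1 ≤ c.length := by
  induction m generalizing x with
  | zero => exact absurd hp.length_lt (by omega)
  | succ m ih =>
    by_cases hext : ∃ y ∈ neighborsAvoiding G p.support.toFinset x,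
        k ≤ ((neighborsAvoiding G (insert y p.support.toFinset) y).biUnion
          (reachAvoiding G (insert y p.support.toFinset))).card
    · obtain ⟨y, hy, hky⟩ := hext
      obtain ⟨hadj, hyp⟩ := mem_neighborsAvoiding.1 hy
      refine ih (SimpleGraph.Walk.cons hadj.symm p) ?_ ?_ ?_
      · exact hp.cons (by simpa using hyp)
      · rw [SimpleGraph.Walk.length_cons]; omega
      · simpa using hky
    · push Not at hext
      obtain ⟨Z, hZ, h1, h2, h3⟩ := exists_boundary_subset _ _ hk hext
      -- At least `t` boundary vertices lie on the path, so one is at least `t - 1` steps from `x`.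
      -- The edges `wu` and `xy` bring the cycle to length `t + 1`.
      obtain ⟨u, hu, hup, hlen⟩ := exists_far_mem (t := t - 1) p _
        (fun v hv => by simpa using h3 hv) (by have := hexp _ h1 h2; omega)
      obtain ⟨-, w, hw, hwu⟩ := mem_outerBoundary.1 hu
      obtain ⟨y, hy, hw⟩ := Finset.mem_biUnion.1 hw
      obtain ⟨q, hq⟩ := mem_reachAvoiding.1 hw
      obtain ⟨v, c, hc, hl⟩ := exists_cycle_of_path p hp hup hlen (by omega)
        (mem_neighborsAvoiding.1 (hZ hy)).1 q (fun v hv => by simpa using hq v hv) hwu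
      exact ⟨v, c, hc, by omega⟩

/-- A graph in which all vertex sets with between `k / 2` and `k` vertices have at least `t`
outer neighbours contains a cycle with more than `t` vertices. -/
theorem exists_cycle_of_boundary {k t : ℕ} (ht : 2 ≤ t) (hk : k ≤ Fintype.card V)
    (hexp : ∀ W : Finset V, k ≤ 2 * W.card → W.card ≤ k → t ≤ (outerBoundary G W).card) :
    ∃ (v : V) (c : G.Walk v v), c.IsCycle ∧ t + 1 ≤ c.length := by
  by_cases hext : ∃ y : V, k ≤ ((neighborsAvoiding G (insert y ∅) y).biUnion
          (reachAvoiding G (insert y ∅))).card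
  · obtain ⟨y, hy⟩ := hext
    exact exists_cycle_of_path_of_boundary ht hexp (Fintype.card V)
      (SimpleGraph.Walk.nil : G.Walk y y) (by simp) (by simp) (by simpa using hy)
  · push Not at hext
    have huniv : (Finset.univ : Finset V).biUnion (reachAvoiding G ∅) = Finset.univ := by
      ext v
      simp only [Finset.mem_biUnion, Finset.mem_univ, true_and, iff_true]
      exact ⟨v, mem_reachAvoiding.2 ⟨SimpleGraph.Walk.nil, by simp⟩⟩
    -- If no starting vertex works, the empty path is already stuck, and the resulting set has empty
    -- boundary.
    obtain ⟨Z, -, h1, h2, h3⟩ := exists_boundary_subset (G := G) ∅ Finset.univ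
      (by rw [huniv]; simpa using hk) (fun y _ => hext y)
    have := hexp _ h1 h2
    rw [Finset.subset_empty.1 h3] at this
    simp at this
    omega

end Reach

/-! ### From local sparsity to large boundaries -/

/-- A locally sparse graph with many edges contains a long cycle. -/
theorem exists_cycle_of_sparse {V : Type*} [Fintype V] [DecidableEq V] {G : SimpleGraph V}
    {M : Finset (Sym2 V)} (hMG : ∀ e ∈ M, e ∈ G.edgeSet) {c₁ c₂ s : ℝ} {k t K : ℕ}
    (hM : c₁ * Fintype.card V + s ≤ M.card) (hc : c₂ ≤ c₁)
    (hsparse : ∀ U : Finset V, k ≤ 2 * U.card → U.card ≤ K →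
      ((M ∩ U.sym2).card : ℝ) < c₂ * U.card)
    (hc₁ : 0 ≤ c₁) (ht : 2 ≤ t) (hK : k + t ≤ K) (hkV : k ≤ Fintype.card V)
    (hs : c₂ * k ≤ s) (hkt : c₂ * (k / 2 + t) ≤ c₁ * (k / 2)) :
    ∃ (v : V) (c : G.Walk v v), c.IsCycle ∧ t + 1 ≤ c.length := by
  classical
  obtain ⟨H, hH, hmin⟩ := Finset.exists_min_image
    (Finset.univ.filter fun H : Finset V => c₁ * H.card + s ≤ (M ∩ H.sym2).card) Finset.card
    ⟨Finset.univ, by simpa [Finset.sym2_univ] using hM⟩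
  rw [Finset.mem_filter] at hH
  replace hH := hH.2
  have hlt : ∀ U : Finset V, U.card < H.card → ((M ∩ U.sym2).card : ℝ) < c₁ * U.card + s := by
    intro U hU
    by_contra! h
    exact absurd (hmin U (by simpa using h)) (by omega)
  -- A smaller `H` could be padded to `k` vertices, where sparsity allows fewer than `c₂ * k ≤ s`
  -- edges.
  have hHk : k ≤ H.card := by
    by_contra! h
    obtain ⟨U, hHU, hU⟩ := Finset.exists_superset_card_eq h.le hkV
    have h1 := hsparse U (by omega) (by omega)
    have h2 : ((M ∩ H.sym2).card : ℝ) ≤ (M ∩ U.sym2).card := by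
      exact_mod_cast Finset.card_le_card
        (Finset.inter_subset_inter_left (Finset.sym2_mono hHU))
    rw [hU] at h1
    have : 0 ≤ c₁ * H.card := by positivity
    linarith
  let G' : SimpleGraph H := G.comap Subtype.val
  have hcycle : ∃ (v : H) (c : G'.Walk v v), c.IsCycle ∧ t + 1 ≤ c.length := by
    refine exists_cycle_of_boundary (k := k) ht (by simpa using hHk) fun W hkW hWk => ?_
    by_contra! hN
    set W' : Finset V := W.map (Function.Embedding.subtype _) with hW'
    set N' : Finset V := (outerBoundary G' W).map (Function.Embedding.subtype _) with hN'
    have hW'c : W'.card = W.card := Finset.card_map _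
    have hN'c : N'.card = (outerBoundary G' W).card := Finset.card_map _
    have hW'H : W' ⊆ H := by
      intro a ha
      obtain ⟨x, -, rfl⟩ := Finset.mem_map.1 ha
      exact x.2
    have hmem : ∀ a b : V, G.Adj a b → a ∈ W' → b ∈ H → b ∈ W' ∪ N' := by
      intro a b hab ha hb
      by_cases hbW : b ∈ W'
      · exact Finset.mem_union_left _ hbW
      · refine Finset.mem_union_right _ (Finset.mem_map.2 ⟨⟨b, hb⟩, ?_, rfl⟩)
        obtain ⟨x, hx, rfl⟩ := Finset.mem_map.1 ha
        refine mem_outerBoundary.2 ⟨fun h => hbW (Finset.mem_map.2 ⟨_, h, rfl⟩), x, hx, hab⟩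
    -- Every edge inside `H` that meets `W'` stays inside `W' ∪ N'`, so deleting `W'` loses fewer
    -- than `c₂ * (|W| + t) ≤ c₁ * |W|` edges.
    have hsub : M ∩ H.sym2 ⊆ (M ∩ (H \ W').sym2) ∪ (M ∩ (W' ∪ N').sym2) := by
      intro e he
      obtain ⟨heM, heH⟩ := Finset.mem_inter.1 he
      have hadj := hMG e heM
      induction e using Sym2.ind with
      | _ a b =>
        rw [Finset.mk_mem_sym2_iff] at heH
        rw [SimpleGraph.mem_edgeSet] at hadj
        simp only [Finset.mem_union, Finset.mem_inter, heM, true_and, Finset.mk_mem_sym2_iff,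
          Finset.mem_sdiff, heH]
        by_cases ha : a ∈ W'
        · have := hmem a b hadj ha heH.2
          rw [Finset.mem_union] at this
          tauto
        · by_cases hb : b ∈ W'
          · have := hmem b a hadj.symm hb heH.1
            rw [Finset.mem_union] at this
            tauto
          · tauto
    have h1 : ((M ∩ H.sym2).card : ℝ) ≤ (M ∩ (H \ W').sym2).card
        + (M ∩ (W' ∪ N').sym2).card := by
      exact_mod_cast (Finset.card_le_card hsub).trans (Finset.card_union_le _ _)
    have hcu : (W' ∪ N').card ≤ W.card + t := by
      have := Finset.card_union_le W' N'
      omega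
    have hcW : W.card ≤ (W' ∪ N').card :=
      hW'c ▸ Finset.card_le_card Finset.subset_union_left
    have h2 := hsparse (W' ∪ N') (by omega) (by omega)
    have hkWr : (k : ℝ) ≤ 2 * W.card := by exact_mod_cast hkW
    have hHW : ((H \ W').card : ℝ) = H.card - W.card := by
      rw [← hW'c, ← Finset.card_sdiff_add_card_eq_card hW'H]; push_cast; ring
    have hWpos : 0 < W.card := by
      rcases Nat.eq_zero_or_pos W.card with h | h
      · have hk0 : k = 0 := by omega
        have : W' ∪ N' = ∅ := by
          have : W = ∅ := Finset.card_eq_zero.1 h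
          have hb : outerBoundary G' W = ∅ := by
            ext v; simp [mem_outerBoundary, this]
          rw [hW', hN', hb, this]; simp
        rw [this] at h2
        simp at h2
      · exact h
    have h3 := hlt (H \ W') (by
      rw [Finset.card_sdiff_of_subset hW'H, hW'c]
      have := Finset.card_le_card hW'H
      omega)
    rw [hHW] at h3
    have hcur : ((W' ∪ N').card : ℝ) ≤ W.card + t := by exact_mod_cast hcu
    rcases le_or_gt c₂ 0 with hneg | hpos
    · have : (0 : ℝ) ≤ (M ∩ (W' ∪ N').sym2).card := by positivity
      nlinarith [mul_nonneg_of_nonpos_of_nonpos hneg hneg,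
        (by positivity : (0 : ℝ) ≤ (W' ∪ N').card)]
    · have := mul_le_mul_of_nonneg_left hcur hpos.le
      nlinarith
  obtain ⟨v, c, hcyc, hlen⟩ := hcycle
  let φ : G' →g G := SimpleGraph.Hom.comap Subtype.val G
  exact ⟨φ v, c.map φ, hcyc.map Subtype.val_injective, (c.length_map φ).symm ▸ hlen⟩

/-! ### Weights that detect dense vertex sets -/

theorem card_inter_sym2_le {V : Type*} [Fintype V] [DecidableEq V]
    (E : Finset (Sym2 V)) (U : Finset V) : (E ∩ U.sym2).card ≤ U.card ^ 2 := by
  refine (Finset.card_le_card Finset.inter_subset_right).trans ?_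
  rw [Finset.card_sym2, Nat.choose_two_right, Nat.add_sub_cancel]
  apply Nat.div_le_of_le_mul
  nlinarith [Nat.le_mul_self U.card]

/-- The expected number of dense vertex sets, as measured by the potential, is exponentially
small. -/
theorem sum_weight_le {V : Type*} [Fintype V] [DecidableEq V] (E : Finset (Sym2 V))
    (𝒰 : Finset (Finset V)) {L a p : ℝ} (ha : a * L = L + 11) (hp : 0 ≤ p)
    (hp3 : p * Fintype.card V ≤ 3) (hL : 0 ≤ L)
    (h𝒰 : ∀ U ∈ 𝒰, Real.exp (-L) * Fintype.card V / 4 ≤ U.card ∧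
      (U.card : ℝ) ≤ Real.exp (-L) * Fintype.card V) :
    ∑ U ∈ 𝒰, Real.exp (-(a * L * U.card)) * (1 + p * (Real.exp L - 1)) ^ (E ∩ U.sym2).card
      ≤ Real.exp (-(Real.exp (-L) * Fintype.card V)) := by
  set κ := Real.exp (-L) with hκ
  set n := Fintype.card V with hn
  have hκ0 : 0 < κ := Real.exp_pos _
  have hκL : κ * Real.exp L = 1 := by rw [hκ, ← Real.exp_add]; simp
  have hL1 : 1 ≤ Real.exp L := Real.one_le_exp hL
  have hterm : ∀ U ∈ 𝒰, Real.exp (-(a * L * U.card))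
      * (1 + p * (Real.exp L - 1)) ^ (E ∩ U.sym2).card
      ≤ Real.exp (-(2 * κ * n)) * κ ^ U.card := by
    intro U hU
    obtain ⟨h1, h2⟩ := h𝒰 U hU
    have hpL : 0 ≤ p * (Real.exp L - 1) := mul_nonneg hp (by linarith)
    have hbase : 1 + p * (Real.exp L - 1) ≤ Real.exp (p * Real.exp L) := by
      have := Real.add_one_le_exp (p * Real.exp L)
      nlinarith
    have hpow : (1 + p * (Real.exp L - 1)) ^ (E ∩ U.sym2).card
        ≤ Real.exp (3 * U.card) := by
      calc (1 + p * (Real.exp L - 1)) ^ (E ∩ U.sym2).card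
          ≤ (1 + p * (Real.exp L - 1)) ^ (U.card ^ 2) :=
            pow_le_pow_right₀ (by linarith) (card_inter_sym2_le E U)
        _ ≤ Real.exp (p * Real.exp L) ^ (U.card ^ 2) :=
            pow_le_pow_left₀ (by linarith) hbase _
        _ = Real.exp ((U.card : ℝ) ^ 2 * (p * Real.exp L)) := by
            rw [← Real.exp_nat_mul]; push_cast; rfl
        _ ≤ Real.exp (3 * U.card) := by
            apply Real.exp_le_exp.2
            have hK : (0 : ℝ) ≤ U.card := by positivity
            have h3 : (U.card : ℝ) * (p * Real.exp L) ≤ 3 := by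
              calc (U.card : ℝ) * (p * Real.exp L) ≤ κ * n * (p * Real.exp L) :=
                    mul_le_mul_of_nonneg_right h2 (by positivity)
                _ = (κ * Real.exp L) * (p * n) := by ring
                _ ≤ 3 := by rw [hκL, one_mul]; exact hp3
            nlinarith [mul_le_mul_of_nonneg_left h3 hK]
    -- The 11 in `ha` splits as 3, cancelling the moment bound, plus 8, which gives `exp (-2κn)`
    -- because `|U| ≥ κn/4`. The remaining `κ ^ |U|` sums over all sets to `(1 + κ) ^ n ≤ exp (κn)`.
    calc _ ≤ Real.exp (-(a * L * U.card)) * Real.exp (3 * U.card) :=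
          mul_le_mul_of_nonneg_left hpow (Real.exp_pos _).le
      _ = Real.exp (-(8 * U.card)) * κ ^ U.card := by
          rw [ha, hκ, ← Real.exp_nat_mul, ← Real.exp_add, ← Real.exp_add]
          congr 1; ring
      _ ≤ _ := by
          refine mul_le_mul_of_nonneg_right (Real.exp_le_exp.2 ?_) (by positivity)
          linarith
  calc _ ≤ ∑ U ∈ 𝒰, Real.exp (-(2 * κ * n)) * κ ^ U.card := Finset.sum_le_sum hterm
    _ ≤ ∑ U : Finset V, Real.exp (-(2 * κ * n)) * κ ^ U.card :=
        Finset.sum_le_sum_of_subset_of_nonneg (Finset.subset_univ _) fun _ _ _ => by positivity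
    _ = Real.exp (-(2 * κ * n)) * (κ + 1) ^ n := by
        rw [← Finset.mul_sum, hn, ← Fintype.sum_pow_mul_eq_add_pow V κ 1]
        simp
    _ ≤ Real.exp (-(2 * κ * n)) * Real.exp κ ^ n :=
        mul_le_mul_of_nonneg_left (pow_le_pow_left₀ (by positivity) (Real.add_one_le_exp κ) _)
          (Real.exp_pos _).le
    _ = Real.exp (-(κ * n)) := by
        rw [← Real.exp_nat_mul, ← Real.exp_add]; congr 1; ring

theorem sq_mul_exp_neg_le_one {κ x : ℝ} (hκ : 0 < κ) (hx : 6 ≤ κ ^ 3 * x) :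
    x ^ 2 * Real.exp (-(κ * x)) ≤ 1 := by
  have hx0 : 0 < x := by
    by_contra! h
    nlinarith [mul_nonpos_of_nonneg_of_nonpos (pow_pos hκ 3).le h]
  have h := Real.pow_div_factorial_le_exp (κ * x) (by positivity) 3
  rw [Real.exp_neg, ← div_eq_mul_inv, div_le_one (Real.exp_pos _)]
  refine le_trans ?_ h
  have h6 : ((Nat.factorial 3 : ℕ) : ℝ) = 6 := by norm_num [Nat.factorial]
  rw [h6, le_div_iff₀ (by norm_num)]
  nlinarith [mul_le_mul_of_nonneg_left hx (sq_nonneg x)]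

/-- Client can force a graph with many edges in which all vertex sets in the given range are
sparse. -/
theorem exists_strategy_sparse {ε L : ℝ} (hε0 : 0 < ε) (hε1 : ε < 1) (hL : ε * L = 88) {n b : ℕ}
    (hn : 6 ≤ Real.exp (-L) ^ 3 * n) (hεn : 4 ≤ ε * n) (hb : (b : ℝ) ≤ (1 - ε) * n / 2) :
    ∃ σ : Strategy (Fin n), ∀ h, IsPlay b σ h → unclaimed h = ∅ →
      ∃ M ⊆ picks h, M ⊆ (⊤ : SimpleGraph (Fin n)).edgeFinset ∧
        (1 + ε / 2) * (n - 1) - 1 ≤ M.card ∧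
        ∀ U : Finset (Fin n), Real.exp (-L) * n / 4 ≤ U.card → U.card ≤ Real.exp (-L) * n →
          ((M ∩ U.sym2).card : ℝ) < (1 + ε / 8) * U.card := by
  have hL0 : 0 < L := by
    by_contra! h
    nlinarith
  have hn0 : (0 : ℝ) < n := by
    by_contra! h
    nlinarith
  have hn4 : (4 : ℝ) < n := by nlinarith
  set p : ℝ := (2 + ε) / n with hp
  have hpn : p * n = 2 + ε := by rw [hp]; field_simp
  have hp0 : 0 ≤ p := by positivity
  have hpb : p * (b + 1) ≤ 1 := by
    have h1 : (b : ℝ) + 1 ≤ n * ((1 - ε / 2) / 2) := by nlinarith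
    calc p * (b + 1) ≤ p * (n * ((1 - ε / 2) / 2)) := mul_le_mul_of_nonneg_left h1 hp0
      _ = (2 + ε) * ((1 - ε / 2) / 2) := by rw [← mul_assoc, hpn]
      _ ≤ 1 := by nlinarith
  set 𝒰 : Finset (Finset (Fin n)) := Finset.univ.filter fun U =>
    Real.exp (-L) * n / 4 ≤ U.card ∧ (U.card : ℝ) ≤ Real.exp (-L) * n with h𝒰
  -- The exponential makes a set with at least `(1 + ε/8) |U|` marked edges weigh at least `n ^ 2`,
  -- more than the edge count can offset.
  set c : Finset (Fin n) → ℝ := fun U =>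
    (n : ℝ) ^ 2 * Real.exp (-((1 + ε / 8) * L * U.card)) with hc
  have hc0 : ∀ U, 0 ≤ c U := fun U => by positivity
  obtain ⟨σ, hσ⟩ := exists_strategy_potential_le b 𝒰 c (fun U _ => hc0 U) hp0
    (Real.one_le_exp hL0.le) hpb
  refine ⟨σ, fun h hh hu => ?_⟩
  obtain ⟨M, hMp, hME, hpot⟩ := hσ h hh hu
  refine ⟨M, hMp, hME, ?_⟩
  have hE : (((⊤ : SimpleGraph (Fin n)).edgeFinset.card : ℕ) : ℝ) = n * (n - 1) / 2 := by
    rw [SimpleGraph.card_edgeFinset_top_eq_card_choose_two, Fintype.card_fin,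
      Nat.cast_choose_two]
  have hinit : potential 𝒰 c p (Real.exp L) ∅ (⊤ : SimpleGraph (Fin n)).edgeFinset
      ≤ 1 - (1 + ε / 2) * (n - 1) := by
    have hw := sum_weight_le (⊤ : SimpleGraph (Fin n)).edgeFinset 𝒰 (L := L) (a := 1 + ε / 8)
      (p := p) (by nlinarith) hp0 (by rw [Fintype.card_fin, hpn]; linarith) hL0.le
      (by simp [h𝒰])
    have hw' := (mul_le_mul_of_nonneg_left hw (sq_nonneg (n : ℝ))).trans
      (by simpa using sq_mul_exp_neg_le_one (Real.exp_pos _) hn)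
    rw [Finset.mul_sum] at hw'
    rw [potential, hE]
    have hlin : p * (n * (n - 1) / 2) = (1 + ε / 2) * (n - 1) := by
      rw [show p * ((n : ℝ) * (n - 1) / 2) = p * n * ((n - 1) / 2) by ring, hpn]; ring
    rw [hlin]
    have hsum : ∑ U ∈ 𝒰, c U * (Real.exp L ^ (∅ ∩ U.sym2 : Finset (Sym2 (Fin n))).card *
        (1 + p * (Real.exp L - 1)) ^ ((⊤ : SimpleGraph (Fin n)).edgeFinset ∩ U.sym2).card) ≤ 1 := by
      refine le_trans (le_of_eq (Finset.sum_congr rfl fun U _ => ?_)) hw'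
      simp only [hc, Finset.empty_inter, Finset.card_empty, pow_zero, one_mul, mul_assoc]
    simp only [Finset.card_empty, Nat.cast_zero]
    linarith
  have hfin := hpot.trans hinit
  simp only [potential, Finset.empty_inter, Finset.card_empty, pow_zero, Nat.cast_zero,
    mul_zero, mul_one, add_zero] at hfin
  have hterm0 : ∀ U ∈ 𝒰, 0 ≤ c U * Real.exp L ^ (M ∩ U.sym2).card :=
    fun U _ => mul_nonneg (hc0 U) (by positivity)
  constructor
  · have := Finset.sum_nonneg hterm0
    linarith
  · intro U hU1 hU2
    by_contra! hdense
    have hUm : U ∈ 𝒰 := by simp [h𝒰, hU1, hU2]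
    have hle := Finset.single_le_sum hterm0 hUm
    have hbig : (n : ℝ) ^ 2 ≤ c U * Real.exp L ^ (M ∩ U.sym2).card := by
      have : 1 ≤ Real.exp (-((1 + ε / 8) * L * U.card)) * Real.exp L ^ (M ∩ U.sym2).card := by
        rw [← Real.exp_nat_mul, ← Real.exp_add]
        apply Real.one_le_exp
        nlinarith [mul_le_mul_of_nonneg_left hdense hL0.le]
      simp only [hc]
      rw [mul_assoc]
      exact le_mul_of_one_le_right (by positivity) this
    have hMc : (M.card : ℝ) ≤ n * (n - 1) / 2 := by
      rw [← hE]; exact_mod_cast Finset.card_le_card hME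
    nlinarith

end ClientWaiter

/-! ### Choice of constants -/

theorem theorem7 (ε : ℝ) (hε0 : 0 < ε) (hε1 : ε < 1) :
    ∃ δ : ℝ, 0 < δ ∧ ∃ n₀ : ℕ, ∀ n : ℕ, n₀ < n →
      ∀ b : ℕ, (b : ℝ) ≤ (1 - ε) * (n : ℝ) / 2 →
        ∃ σ : ClientWaiter.Strategy (Fin n),
          σ.IsWinning b
            (fun G => ClientWaiter.HasCycleOfLengthAtLeast G (δ * (n : ℝ))) := by
  -- With this `L`, the excess `ε/8` in density gives `(1 + ε/8) * L = L + 11`, as `sum_weight_le`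
  -- needs.
  set L : ℝ := 88 / ε with hLdef
  have hL : ε * L = 88 := by rw [hLdef]; field_simp
  obtain ⟨κ, hκ⟩ : ∃ κ, κ = Real.exp (-L) := ⟨_, rfl⟩
  have hκ0 : 0 < κ := hκ ▸ Real.exp_pos _
  have hκε : 88 * κ ≤ ε := by
    have h1 : κ * Real.exp L = 1 := by rw [hκ, ← Real.exp_add]; simp
    have h2 : κ * L ≤ 1 := by
      rw [← h1]
      exact mul_le_mul_of_nonneg_left (by linarith [Real.add_one_le_exp L]) hκ0.le
    nlinarith
  have hκ1 : κ < 1 := by linarith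
  refine ⟨κ * ε / 100, by positivity, ⌈10000 / (κ ^ 3 * ε)⌉₊, fun n hn b hb => ?_⟩
  have hC : 10000 ≤ κ ^ 3 * ε * n := by
    have := (Nat.lt_of_ceil_lt hn).le
    rw [div_le_iff₀ (by positivity)] at this
    linarith
  have hn0 : (0 : ℝ) ≤ n := by positivity
  have hκ3 : κ ^ 3 ≤ κ := pow_le_of_le_one hκ0.le hκ1.le (by norm_num)
  have hX : 10000 ≤ κ * ε * n := by
    refine hC.trans ?_
    gcongr
  have hκn : κ * ε * n ≤ κ * n := by
    gcongr
    nlinarith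
  have hεn : κ * ε * n ≤ ε * n := by
    gcongr
    nlinarith
  have hκ3n : κ ^ 3 * ε * n ≤ κ ^ 3 * n := by
    gcongr
    nlinarith [pow_pos hκ0 3]
  have hκεn : 88 * (κ * n) ≤ ε * n := by
    rw [← mul_assoc]
    gcongr
  have hκn' : κ * n ≤ n := by nlinarith
  obtain ⟨σ, hσ⟩ := ClientWaiter.exists_strategy_sparse hε0 hε1 hL (n := n) (b := b)
    (by rw [← hκ]; linarith) (by linarith) hb
  rw [← hκ] at hσ
  refine ⟨σ, fun h hh hu => ?_⟩
  obtain ⟨M, hMp, hME, hMc, hsparse⟩ := hσ h hh hu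
  have hk1 := Nat.le_ceil (κ * n / 2)
  have hk2 := Nat.ceil_lt_add_one (by positivity : 0 ≤ κ * n / 2)
  have ht1 := Nat.le_ceil (κ * ε / 100 * n)
  have ht2 := Nat.ceil_lt_add_one (by positivity : 0 ≤ κ * ε / 100 * n)
  have hK1 := Nat.floor_le (by positivity : 0 ≤ κ * n)
  have hK2 := Nat.lt_floor_add_one (κ * n)
  set k := ⌈κ * n / 2⌉₊
  set t := ⌈κ * ε / 100 * n⌉₊
  set K := ⌊κ * n⌋₊
  have hMG : ∀ e ∈ M, e ∈ (ClientWaiter.clientGraph h).edgeSet := by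
    intro e he
    have h1 := hMp he
    have h2 := hME he
    simp only [ClientWaiter.picks, List.mem_toFinset, List.mem_map] at h1
    rw [SimpleGraph.mem_edgeFinset, SimpleGraph.edgeSet_top] at h2
    rw [ClientWaiter.clientGraph, SimpleGraph.edgeSet_fromEdgeSet]
    exact ⟨h1, h2⟩
  -- The surplus of `M` over `c₁ * n` is about `εn/4`, which covers `s`. The gap `c₁ - c₂ = ε/8` on
  -- `k/2 ≥ κn/4` vertices pays for `t ≈ κεn/100`, and `88κ ≤ ε` gives `c₂ * k ≤ s`.
  obtain ⟨v, c, hcyc, hlen⟩ := ClientWaiter.exists_cycle_of_sparse hMG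
    (c₁ := 1 + ε / 4) (c₂ := 1 + ε / 8) (s := ε / 12 * n) (k := k) (t := t) (K := K)
    (by rw [Fintype.card_fin]; linarith)
    (by linarith)
    (by
      intro U hU1 hU2
      have hU1' : (k : ℝ) ≤ 2 * U.card := by exact_mod_cast hU1
      have hU2' : (U.card : ℝ) ≤ K := by exact_mod_cast hU2
      exact hsparse U (by linarith) (by linarith))
    (by linarith)
    (by
      have : (1 : ℝ) < t := by linarith
      exact_mod_cast this)
    (by
      have : ((k + t : ℕ) : ℝ) < (K + 1 : ℕ) := by push_cast; linarith
      exact Nat.lt_succ_iff.1 (by exact_mod_cast this))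
    (by
      rw [Fintype.card_fin]
      have : (k : ℝ) ≤ n := by linarith
      exact_mod_cast this)
    (by nlinarith)
    (by nlinarith)
  refine ⟨v, c, hcyc, ht1.trans ?_⟩
  exact_mod_cast (Nat.le_succ t).trans hlen
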